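/- Let $d\ge 2$, let $T=\{1,\dots,d\}^*$ be the $d$-regular rooted tree, with level $n$ the set of words of length $n$ and $T_v$ the subtree of words with prefix $v$, and let $G\le\operatorname{Aut}(T)$ be a finitely generated group. For $H\le\operatorname{Aut}(T)$ and a set $V$ of vertices, $\operatorname{Stab}_H(V)$ is the pointwise stabilizer of $V$ in $H$; for a vertex $v$ write $\operatorname{Stab}_H(v)=\operatorname{Stab}_H(\{v\})$ and let $\operatorname{Rist}_G(v)$ be the group of elements of $G$ that act trivially outside $T_v$. The section $\varphi_v(g)\in\operatorname{Aut}(T)$ of $g\in\operatorname{Aut}(T)$ at $v$ is defined by $g(vw)=g(v)\,\varphi_v(g)(w)$ for all $w\in T$. The group $G$ is *weakly branch* if it acts transitively on every level of $T$ and $\operatorname{Rist}_G(v)$ is infinite for every vertex $v$; it is *branch* if moreover, for every $n$, the subgroup generated by the groups $\operatorname{Rist}_G(v)$ with $v$ of level $n$ has finite index in $G$. A *transversal* is a set $X$ of vertices such that every infinite ray from the root passes through exactly one element of $X$. The group $G$ has the *subgroup induction property* if for every finitely generated $H\le G$ there is a transversal $X$ such that for each $v\in X$ the group $\varphi_v(\operatorname{Stab}_H(X))$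 is trivial or has finite index in $\varphi_v(\operatorname{Stab}_G(v))$. If $G$ is self-similar, that is, if $\varphi_v(\operatorname{Stab}_G(v))\le G$ for all $v$, the following definition of the subgroup induction property is also allowed: every inductive class of subgroups of $G$ contains all finitely generated subgroups of $G$. Here a class $\mathcal X$ of subgroups of $G$ is *inductive* if (A) $\{1\},G\in\mathcal X$; (B) whenever $H\le L\le G$ with $[L:H]<\infty$, one has $L\in\mathcal X$ if and only if $H\in\mathcal X$; (C) every finitely generated subgroup $H\le G$ that fixes all vertices of level $1$ and satisfies $\varphi_v(H)\in\mathcal X$ for all $v$ of level $1$ belongs to $\mathcal X$. **Theorem.** Let $G\le\operatorname{Aut}(T)$ be a finitely generated weakly branch group with the subgroup induction property (in either of the two senses above). Then $G$ is torsion. If $G$ is branch, then: 1. $G$ is just infinite, that is, $G$ is infinite and $G/N$ is finite for every nontrivial normal subgroup $N$ of $G$; 2. if $G$ is a $p$-group for some prime $p$, then every maximal subgroup of $G$ has finite index in $G$; 3. more generally, if the intersection $\Phi_F(G)$ of all maximal subgroups of finite index of $G$ is nontrivial, then every maximal subgroup of $G$ has finite index in $G$. -/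

import Mathlib

namespace BranchGroups

/-- Vertices of the `d`-regular rooted tree: finite words over an alphabet with `d` letters. The root
is the empty word, the level of a vertex is its length, and `w` lies in the subtree rooted at `v`
exactly when `v` is a prefix of `w`. -/
abbrev Vertex (d : ℕ) : Type := List (Fin d)

/-- The group of automorphisms of the rooted tree: the bijections of the vertices which preserve
the tree order (the prefix order) in both directions. The product is composition. -/
abbrev TreeAut (d : ℕ) : Type :=
  (List.IsPrefix : Vertex d → Vertex d → Prop) ≃r (List.IsPrefix : Vertex d → Vertex d → Prop)

variable {d : ℕ}

theorem TreeAut.prefix_apply_append (g : TreeAut d) (v w : Vertex d) : g v <+: g (v ++ w) :=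
  g.map_rel_iff.2 (List.prefix_append v w)

/-- The word `u` with `g (v ++ w) = g v ++ u`. -/
def sectionFun (v : Vertex d) (g : TreeAut d) (w : Vertex d) : Vertex d :=
  (g (v ++ w)).drop (g v).length

theorem apply_append_sectionFun (v : Vertex d) (g : TreeAut d) (w : Vertex d) :
    g (v ++ w) = g v ++ sectionFun v g w :=
  (List.prefix_iff_eq_append.1 (g.prefix_apply_append v w)).symm

theorem sectionFun_inv_sectionFun (v : Vertex d) (g : TreeAut d) (w : Vertex d) :
    sectionFun (g v) g⁻¹ (sectionFun v g w) = w := by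
  have h := apply_append_sectionFun (g v) g⁻¹ (sectionFun v g w)
  rw [← apply_append_sectionFun, RelIso.inv_apply_self, RelIso.inv_apply_self] at h
  exact (List.append_cancel_left h).symm

/-- The section `φ_v(g)` of `g` at `v`: the automorphism with
`g (v ++ w) = g v ++ φ_v(g) w` for all `w`. -/
def treeSection (v : Vertex d) (g : TreeAut d) : TreeAut d where
  toFun := sectionFun v g
  invFun := sectionFun (g v) g⁻¹
  left_inv := sectionFun_inv_sectionFun v g
  right_inv w := by
    have h := sectionFun_inv_sectionFun (g v) g⁻¹ w
    rwa [RelIso.inv_apply_self, inv_inv] at h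
  map_rel_iff' := by
    intro a b
    have h := g.map_rel_iff (a := v ++ a) (b := v ++ b)
    rw [apply_append_sectionFun, apply_append_sectionFun] at h
    rw [List.prefix_append_right_inj, List.prefix_append_right_inj] at h
    exact h

theorem apply_append (v : Vertex d) (g : TreeAut d) (w : Vertex d) :
    g (v ++ w) = g v ++ treeSection v g w :=
  apply_append_sectionFun v g w

/-- Pointwise stabilizer, in the group of all tree automorphisms, of a set of vertices. -/
def fixing (V : Set (Vertex d)) : Subgroup (TreeAut d) where
  carrier := {g | ∀ v ∈ V, g v = v}
  one_mem' := fun _ _ => rfl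
  mul_mem' := by
    intro a b ha hb v hv
    rw [RelIso.mul_apply, hb v hv, ha v hv]
  inv_mem' := by
    intro a ha v hv
    have h := RelIso.inv_apply_self a v
    rwa [ha v hv] at h

/-- `Stab_G(V)`, the pointwise stabilizer in `G` of a set `V` of vertices. -/
def stab (G : Subgroup (TreeAut d)) (V : Set (Vertex d)) : Subgroup (TreeAut d) :=
  G ⊓ fixing V

/-- `φ_v` as a group homomorphism on the stabilizer of `v`. -/
def sectionHom (v : Vertex d) : fixing {v} →* TreeAut d where
  toFun g := treeSection v g
  map_one' := by
    ext1 w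
    have h := apply_append v (1 : TreeAut d) w
    exact (List.append_cancel_left h).symm
  map_mul' := by
    rintro ⟨a, ha⟩ ⟨b, hb⟩
    have ha' : a v = v := ha v rfl
    have hb' : b v = v := hb v rfl
    ext1 w
    have h := apply_append v (a * b) w
    rw [RelIso.mul_apply, RelIso.mul_apply, apply_append v b, hb', apply_append v a, ha'] at h
    exact (List.append_cancel_left h).symm

/-- `φ_v(Stab_H(v))`. If `H` fixes `v`, this is `φ_v(H)`. -/
def sectionGroup (v : Vertex d) (H : Subgroup (TreeAut d)) : Subgroup (TreeAut d) :=
  (H.subgroupOf (fixing {v})).map (sectionHom v)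

/-- The set of vertices of level `n`. -/
def level (d n : ℕ) : Set (Vertex d) := {v | v.length = n}

/-- `Rist_G(v)`: the elements of `G` acting trivially outside the subtree rooted at `v`. -/
def rist (G : Subgroup (TreeAut d)) (v : Vertex d) : Subgroup (TreeAut d) :=
  stab G {w | ¬ v <+: w}

/-- The rigid stabilizer of the level `n`: the subgroup generated by the rigid stabilizers of the
vertices of level `n`. -/
def ristLevel (G : Subgroup (TreeAut d)) (n : ℕ) : Subgroup (TreeAut d) :=
  ⨆ v ∈ level d n, rist G v

/-- `G` acts transitively on every level and all rigid stabilizers of vertices are infinite. -/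
structure IsWeaklyBranch (G : Subgroup (TreeAut d)) : Prop where
  transitive : ∀ n, ∀ v ∈ level d n, ∀ w ∈ level d n, ∃ g ∈ G, g v = w
  infinite_rist : ∀ v, Infinite (rist G v)

/-- `G` is weakly branch and the rigid stabilizers of all levels have finite index in `G`. -/
structure IsBranch (G : Subgroup (TreeAut d)) : Prop extends IsWeaklyBranch G where
  finiteIndex_ristLevel : ∀ n, (ristLevel G n).IsFiniteRelIndex G

/-- `φ_v(Stab_G(v)) ≤ G` for all vertices `v`. -/
def IsSelfSimilar (G : Subgroup (TreeAut d)) : Prop :=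
  ∀ v, sectionGroup v G ≤ G

/-- The vertex of level `n` on the infinite ray from the root labelled by `r`. -/
def rayVertex (r : ℕ → Fin d) (n : ℕ) : Vertex d := (List.range n).map r

/-- Every infinite ray from the root passes through exactly one element of `X`. -/
def IsTransversal (X : Set (Vertex d)) : Prop :=
  ∀ r : ℕ → Fin d, ∃! v, v ∈ X ∧ ∃ n, rayVertex r n = v

/-- The subgroup induction property, in terms of transversals: for every finitely generated
`H ≤ G` there is a transversal `X` such that, for all `v ∈ X`, the section `φ_v(Stab_H(X))` is
trivial or has finite index in `φ_v(Stab_G(v))`. -/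
def HasSubgroupInduction (G : Subgroup (TreeAut d)) : Prop :=
  ∀ H ≤ G, H.FG → ∃ X : Set (Vertex d), IsTransversal X ∧
    ∀ v ∈ X, sectionGroup v (stab H X) = ⊥ ∨
      (sectionGroup v (stab H X)).IsFiniteRelIndex (sectionGroup v G)

/-- Inductive classes of subgroups of a (self-similar) group `G`. -/
structure IsInductiveClass (G : Subgroup (TreeAut d)) (𝒳 : Set (Subgroup (TreeAut d))) :
    Prop where
  le_of_mem : ∀ H ∈ 𝒳, H ≤ G
  bot_mem : ⊥ ∈ 𝒳
  self_mem : G ∈ 𝒳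
  mem_iff_of_finiteIndex : ∀ H L : Subgroup (TreeAut d), H ≤ L → L ≤ G → H.IsFiniteRelIndex L →
    (L ∈ 𝒳 ↔ H ∈ 𝒳)
  mem_of_sections : ∀ H : Subgroup (TreeAut d), H ≤ stab G (level d 1) → H.FG →
    (∀ v ∈ level d 1, sectionGroup v H ∈ 𝒳) → H ∈ 𝒳

/-- The subgroup induction property of a (self-similar) group, in terms of inductive classes: every
inductive class contains all finitely generated subgroups of `G`. -/
def HasInductiveSubgroupInduction (G : Subgroup (TreeAut d)) : Prop :=
  ∀ 𝒳 : Set (Subgroup (TreeAut d)), IsInductiveClass G 𝒳 → ∀ H ≤ G, H.FG → H ∈ 𝒳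

/-- A just infinite group: infinite, and all its quotients by nontrivial normal subgroups are
finite. -/
def IsJustInfinite (Γ : Type*) [Group Γ] : Prop :=
  Infinite Γ ∧ ∀ N : Subgroup Γ, N.Normal → N ≠ ⊥ → Finite (Γ ⧸ N)

/-- `Φ_F(Γ)`: the intersection of the maximal subgroups of finite index. -/
def frattiniFinite (Γ : Type*) [Group Γ] : Subgroup Γ :=
  sInf {M | IsCoatom M ∧ M.FiniteIndex}

/-- All maximal subgroups have finite index. -/
def MaximalSubgroupsFiniteIndex (Γ : Type*) [Group Γ] : Prop :=
  ∀ M : Subgroup Γ, IsCoatom M → M.FiniteIndex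

end BranchGroups

namespace BranchGroups

variable {d : ℕ}

open scoped commutatorElement

/-! ### Tree automorphisms -/

/-! Torsion. Apply subgroup induction to the cyclic group generated by g. The rigid stabilizers of
two children of v embed in φ_v(Stab_G(v)) as infinite subgroups meeting trivially, which is
impossible in a virtually cyclic group (`IsWeaklyBranch.not_isCyclic_section`). So all sections
along the transversal X are trivial; X is finite by compactness of the space of rays, hence g has
finite order. The version with inductive classes reduces to transversals because the subgroups
satisfying `HasInducingTransversal` form an inductive class.

Just infiniteness (`IsBranch.isJustInfinite`). A nontrivial normal subgroup N moves every vertex of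
some level, by transitivity. Conjugating by N pushes one of two elements of Rist(v) off the subtree
at v, so they commute modulo N. Thus G/N is virtually abelian, finitely generated and torsion, hence
finite.

Maximal subgroups. If M is maximal of infinite index and Φ_F(G) is nontrivial, then Φ_F(G) has
finite index and M contains a finitely generated H with H Φ_F(G) = G; such an H is prodense.
Subgroup induction gives either a finite H, which must be G by residual finiteness, or a section of
finite index, which transitivity of H spreads over a whole level. In the latter case a
minimal-support argument (`IsWeaklyBranch.exists_mem_rist_of_isProdense`) finds a nontrivial element
of H supported below one vertex; all its G-conjugates lie in H, so H contains a normal subgroup of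
finite index and equals G (`IsProdense.le_of_hasInducingTransversal`). This contradicts M ≠ G. For
p-groups, Φ_F(G) contains the commutator subgroup, which is nontrivial. -/

theorem length_le_length_apply (g : TreeAut d) (v : Vertex d) : v.length ≤ (g v).length := by
  induction v using List.reverseRecOn with
  | nil => simp
  | append_singleton v a ih =>
    have h := apply_append v g [a]
    have hne : treeSection v g [a] ≠ [] := by
      intro h0
      rw [h0, List.append_nil] at h
      have := g.injective h
      simp at this
    have := List.length_pos_of_ne_nil hne
    rw [h]
    simp only [List.length_append, List.length_singleton]
    omega

-- Automorphisms are only assumed to preserve the prefix order; levels come for free, by comparing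
-- lengths under g and g⁻¹.
@[simp]
theorem length_apply (g : TreeAut d) (v : Vertex d) : (g v).length = v.length := by
  refine le_antisymm ?_ (length_le_length_apply g v)
  have h := length_le_length_apply g⁻¹ (g v)
  rwa [RelIso.inv_apply_self] at h

theorem apply_eq_self_of_prefix {g : TreeAut d} {v w : Vertex d} (h : v <+: w) (hw : g w = w) :
    g v = v := by
  have h1 : g v <+: w := by
    have := g.map_rel_iff.2 h
    rwa [hw] at this
  exact (List.prefix_of_prefix_length_le h1 h (by simp)).eq_of_length (by simp)

theorem mem_fixing {V : Set (Vertex d)} {g : TreeAut d} : g ∈ fixing V ↔ ∀ v ∈ V, g v = v :=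
  Iff.rfl

theorem mem_fixing_singleton {v : Vertex d} {g : TreeAut d} : g ∈ fixing {v} ↔ g v = v := by
  simp [mem_fixing]

theorem fixing_anti {V W : Set (Vertex d)} (h : V ⊆ W) : fixing W ≤ fixing V :=
  fun _ hg v hv => hg v (h hv)

theorem mem_fixing_level_of_le {m n : ℕ} (h : m ≤ n) [NeZero d] {g : TreeAut d}
    (hg : g ∈ fixing (level d n)) : g ∈ fixing (level d m) := by
  intro v hv
  refine apply_eq_self_of_prefix (List.prefix_append v (List.replicate (n - m) 0)) (hg _ ?_)
  have hv' : v.length = m := hv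
  simp only [level, Set.mem_ofPred_eq, List.length_append, List.length_replicate]
  omega

theorem finite_level (d n : ℕ) : (level d n).Finite := List.finite_length_eq (Fin d) n

theorem finiteIndex_fixing_singleton (v : Vertex d) : (fixing {v}).FiniteIndex := by
  let _ : MulAction (TreeAut d) (Vertex d) :=
    { smul := fun g v => g v, one_smul := fun _ => rfl, mul_smul := fun _ _ _ => rfl }
  have h : fixing {v} = MulAction.stabilizer (TreeAut d) v := by
    ext g
    exact mem_fixing_singleton
  have hfin : (MulAction.orbit (TreeAut d) v).Finite := by
    refine (finite_level d v.length).subset ?_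
    rintro _ ⟨g, rfl⟩
    exact length_apply g v
  refine ⟨?_⟩
  rw [h, MulAction.index_stabilizer]
  exact ((Set.ncard_pos hfin).2 ⟨v, MulAction.mem_orbit_self v⟩).ne'

theorem finiteIndex_fixing {V : Set (Vertex d)} (hV : V.Finite) : (fixing V).FiniteIndex := by
  have : Finite V := hV
  have h : fixing V = ⨅ v : V, fixing {(v : Vertex d)} := by
    ext g
    simp [mem_fixing, Subgroup.mem_iInf]
  rw [h]
  exact Subgroup.finiteIndex_iInf fun v : V => finiteIndex_fixing_singleton (v : Vertex d)

theorem relIndex_stab_ne_zero (H : Subgroup (TreeAut d)) {V : Set (Vertex d)} (hV : V.Finite) :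
    (stab H V).relIndex H ≠ 0 := by
  rw [stab, Subgroup.inf_relIndex_left]
  have := finiteIndex_fixing hV
  exact (Subgroup.isFiniteRelIndex_of_finiteIndex (H := fixing V) (K := H)).relIndex_ne_zero

theorem stab_mono {H L : Subgroup (TreeAut d)} (h : H ≤ L) (V : Set (Vertex d)) :
    stab H V ≤ stab L V :=
  inf_le_inf_right _ h

theorem stab_anti (H : Subgroup (TreeAut d)) {V W : Set (Vertex d)} (h : V ⊆ W) :
    stab H W ≤ stab H V :=
  inf_le_inf_left _ (fixing_anti h)

/-! ### Sections -/

theorem treeSection_eq_iff {v : Vertex d} {g h : TreeAut d} (hv : g v = h v) :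
    treeSection v g = treeSection v h ↔ ∀ w, g (v ++ w) = h (v ++ w) := by
  constructor
  · intro e w
    rw [apply_append, apply_append, e, hv]
  · intro e
    ext1 w
    have := e w
    rw [apply_append, apply_append, hv] at this
    exact List.append_cancel_left this

theorem treeSection_eq_one_iff {v : Vertex d} {g : TreeAut d} (hv : g v = v) :
    treeSection v g = 1 ↔ ∀ w, g (v ++ w) = v ++ w := by
  have h : treeSection v (1 : TreeAut d) = 1 := (sectionHom v).map_one
  rw [← h, treeSection_eq_iff (by simpa using hv)]
  simp

theorem treeSection_append (v u : Vertex d) (g : TreeAut d) :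
    treeSection (v ++ u) g = treeSection u (treeSection v g) := by
  ext1 w
  have h := apply_append (v ++ u) g w
  rw [List.append_assoc, apply_append v g (u ++ w), apply_append u, apply_append v g u,
    List.append_assoc] at h
  exact (List.append_cancel_left (List.append_cancel_left h)).symm

theorem apply_append_eq_iff {v u : Vertex d} {g : TreeAut d} (hv : g v = v) :
    g (v ++ u) = v ++ u ↔ treeSection v g u = u := by
  rw [apply_append, hv, List.append_cancel_left_eq]

theorem apply_append_eq_self_iff {v u : Vertex d} {g : TreeAut d} :
    g (v ++ u) = v ++ u ↔ g v = v ∧ treeSection v g u = u :=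
  ⟨fun h => have hv := apply_eq_self_of_prefix (List.prefix_append v u) h
    ⟨hv, (apply_append_eq_iff hv).1 h⟩, fun h => (apply_append_eq_iff h.1).2 h.2⟩

theorem mem_sectionGroup {v : Vertex d} {H : Subgroup (TreeAut d)} {x : TreeAut d} :
    x ∈ sectionGroup v H ↔ ∃ g ∈ H, g v = v ∧ treeSection v g = x := by
  constructor
  · rintro ⟨⟨g, hg⟩, hgH, rfl⟩
    exact ⟨g, hgH, hg v rfl, rfl⟩
  · rintro ⟨g, hgH, hg, rfl⟩
    exact ⟨⟨g, mem_fixing_singleton.2 hg⟩, hgH, rfl⟩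

theorem sectionGroup_mono (v : Vertex d) {H L : Subgroup (TreeAut d)} (h : H ≤ L) :
    sectionGroup v H ≤ sectionGroup v L :=
  Subgroup.map_mono (Subgroup.comap_mono h)

theorem relIndex_map_ne_zero {A B : Type*} [Group A] [Group B] (f : A →* B) {H K : Subgroup A}
    (h : H.relIndex K ≠ 0) : (H.map f).relIndex (K.map f) ≠ 0 := by
  rw [← Subgroup.relIndex_comap]
  exact fun h0 => h (Subgroup.relIndex_eq_zero_of_le_left (Subgroup.le_comap_map f H) h0)

theorem relIndex_sectionGroup_ne_zero (v : Vertex d) {H L : Subgroup (TreeAut d)}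
    (h : H.relIndex L ≠ 0) : (sectionGroup v H).relIndex (sectionGroup v L) ≠ 0 :=
  relIndex_map_ne_zero _ (Subgroup.relIndex_comap_ne_zero _ h)

theorem sectionGroup_append (v u : Vertex d) (H : Subgroup (TreeAut d)) :
    sectionGroup (v ++ u) H = sectionGroup u (sectionGroup v H) := by
  ext x
  simp only [mem_sectionGroup]
  constructor
  · rintro ⟨g, hg, hgv, rfl⟩
    obtain ⟨h1, h2⟩ := apply_append_eq_self_iff.1 hgv
    exact ⟨_, ⟨g, hg, h1, rfl⟩, h2, (treeSection_append v u g).symm⟩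
  · rintro ⟨_, ⟨g, hg, h1, rfl⟩, h2, rfl⟩
    exact ⟨g, hg, apply_append_eq_self_iff.2 ⟨h1, h2⟩, treeSection_append v u g⟩

/-! ### Transversals -/

theorem rayVertex_length (r : ℕ → Fin d) (n : ℕ) : (rayVertex r n).length = n := by
  simp [rayVertex]

theorem rayVertex_add (r : ℕ → Fin d) (m n : ℕ) :
    rayVertex r (m + n) = rayVertex r m ++ rayVertex (fun i => r (m + i)) n := by
  simp [rayVertex, List.range_add]

theorem exists_rayVertex_eq [NeZero d] (v : Vertex d) : ∃ r, rayVertex r v.length = v := by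
  refine ⟨fun i => v.getD i 0, ?_⟩
  apply List.ext_getElem
  · simp [rayVertex]
  · intro i h1 h2
    simp [rayVertex, h2]

/-- There is a level below which every ray has met the transversal. -/
theorem IsTransversal.exists_bound {X : Set (Vertex d)} (hX : IsTransversal X) :
    ∃ N, ∀ r : ℕ → Fin d, ∃ n ≤ N, rayVertex r n ∈ X := by
  -- Meeting X at depth n depends only on the first n letters of the ray, so compactness of the
  -- space of rays applies.
  have hopen : ∀ n, IsOpen {r : ℕ → Fin d | rayVertex r n ∈ X} := by
    intro n
    have hc : Continuous fun (r : ℕ → Fin d) (i : Fin n) => r i := by fun_prop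
    have : {r : ℕ → Fin d | rayVertex r n ∈ X} =
        (fun (r : ℕ → Fin d) (i : Fin n) => r i) ⁻¹' {f | List.ofFn f ∈ X} := by
      ext r
      have : rayVertex r n = List.ofFn fun i : Fin n => r i := by
        apply List.ext_getElem <;> simp [rayVertex]
      simp [this]
    rw [this]
    exact (isOpen_discrete _).preimage hc
  obtain ⟨t, ht⟩ := isCompact_univ.elim_finite_subcover _ hopen (by
    intro r _
    obtain ⟨v, ⟨hv, n, rfl⟩, -⟩ := hX r
    exact Set.mem_iUnion.2 ⟨n, hv⟩)
  refine ⟨t.sup id, fun r => ?_⟩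
  obtain ⟨n, hn, hr⟩ := Set.mem_iUnion₂.1 (ht (Set.mem_univ r))
  exact ⟨n, Finset.le_sup (f := id) hn, hr⟩

theorem IsTransversal.exists_length_le [NeZero d] {X : Set (Vertex d)} (hX : IsTransversal X) :
    ∃ N, ∀ v ∈ X, v.length ≤ N := by
  obtain ⟨N, hN⟩ := hX.exists_bound
  refine ⟨N, fun v hv => ?_⟩
  obtain ⟨r, hr⟩ := exists_rayVertex_eq v
  obtain ⟨n, hn, hnX⟩ := hN r
  have := (hX r).unique ⟨hv, _, hr⟩ ⟨hnX, n, rfl⟩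
  rw [this, rayVertex_length]
  exact hn

theorem IsTransversal.finite [NeZero d] {X : Set (Vertex d)} (hX : IsTransversal X) :
    X.Finite := by
  obtain ⟨N, hN⟩ := hX.exists_length_le
  exact (List.finite_length_le (Fin d) N).subset hN

theorem IsTransversal.eq_one [NeZero d] {X : Set (Vertex d)} (hX : IsTransversal X) {g : TreeAut d}
    (hg : g ∈ fixing X) (h : ∀ v ∈ X, treeSection v g = 1) : g = 1 := by
  ext1 w
  obtain ⟨r, hr⟩ := exists_rayVertex_eq w
  obtain ⟨v, ⟨hv, n, rfl⟩, -⟩ := hX r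
  obtain hn | hn := le_total n w.length
  · obtain ⟨k, hk⟩ := Nat.exists_eq_add_of_le hn
    rw [hk, rayVertex_add] at hr
    rw [← hr]
    exact (treeSection_eq_one_iff (hg _ hv)).1 (h _ hv) _
  · obtain ⟨k, rfl⟩ := Nat.exists_eq_add_of_le hn
    refine apply_eq_self_of_prefix ?_ (hg _ hv)
    rw [rayVertex_add, hr]
    exact List.prefix_append _ _

theorem isTransversal_level (n : ℕ) : IsTransversal (level d n) := by
  intro r
  refine ⟨rayVertex r n, ⟨rayVertex_length r n, n, rfl⟩, ?_⟩
  rintro _ ⟨hv, m, rfl⟩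
  have : (rayVertex r m).length = n := hv
  rw [rayVertex_length] at this
  rw [this]

theorem isTransversal_singleton_nil : IsTransversal ({[]} : Set (Vertex d)) := by
  have h : ({[]} : Set (Vertex d)) = level d 0 := by
    ext v
    simp [level]
  rw [h]
  exact isTransversal_level 0

/-- Replacing each element `v` of a transversal by a transversal of the subtree at `v`. -/
def refinement (X : Set (Vertex d)) (Y : Vertex d → Set (Vertex d)) : Set (Vertex d) :=
  {w | ∃ v ∈ X, ∃ u ∈ Y v, v ++ u = w}

theorem IsTransversal.refinement {X : Set (Vertex d)} (hX : IsTransversal X)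
    {Y : Vertex d → Set (Vertex d)} (hY : ∀ v ∈ X, IsTransversal (Y v)) :
    IsTransversal (refinement X Y) := by
  intro r
  obtain ⟨v, ⟨hv, n, rfl⟩, huniq⟩ := hX r
  obtain ⟨u, ⟨hu, m, rfl⟩, huniq'⟩ := hY _ hv (fun i => r (n + i))
  refine ⟨rayVertex r (n + m), ⟨⟨_, hv, _, hu, (rayVertex_add r n m).symm⟩, _, rfl⟩, ?_⟩
  rintro _ ⟨⟨v', hv', u', hu', rfl⟩, k, hk⟩
  have hle : v'.length ≤ k := by
    have := congrArg List.length hk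
    rw [rayVertex_length, List.length_append] at this
    omega
  obtain ⟨l, rfl⟩ := Nat.exists_eq_add_of_le hle
  rw [rayVertex_add] at hk
  obtain ⟨h1, h2⟩ := List.append_inj hk (rayVertex_length _ _)
  have h3 : v' = rayVertex r n := huniq _ ⟨hv', _, h1⟩
  have hlen : v'.length = n := by rw [h3, rayVertex_length]
  rw [h3] at hu'
  rw [hlen] at h2
  have h4 := huniq' _ ⟨hu', _, h2⟩
  rw [rayVertex_add, h3, h4]

theorem IsTransversal.nonempty [NeZero d] {X : Set (Vertex d)} (hX : IsTransversal X) :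
    X.Nonempty := by
  obtain ⟨v, ⟨hv, -⟩, -⟩ := hX (fun _ => 0)
  exact ⟨v, hv⟩

theorem fixing_refinement_le [NeZero d] (X : Set (Vertex d)) {Y : Vertex d → Set (Vertex d)}
    (hY : ∀ v ∈ X, IsTransversal (Y v)) : fixing (refinement X Y) ≤ fixing X := by
  intro g hg v hv
  obtain ⟨u, hu⟩ := (hY v hv).nonempty
  exact apply_eq_self_of_prefix (List.prefix_append v u) (hg _ ⟨v, hv, u, hu, rfl⟩)

/-- The level stabilizers form a separating family. -/
theorem exists_forall_mem_fixing_level_imp_eq_one [NeZero d] {S : Set (TreeAut d)}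
    (hS : S.Finite) : ∃ m, ∀ g ∈ S, g ∈ fixing (level d m) → g = 1 := by
  induction S, hS using Set.Finite.induction_on with
  | empty => exact ⟨0, by simp⟩
  | @insert a s _ _ ih =>
    obtain ⟨m, hm⟩ := ih
    by_cases ha : a = 1
    · refine ⟨m, ?_⟩
      rintro g (rfl | hg) h
      · exact ha
      · exact hm g hg h
    · obtain ⟨v, hv⟩ : ∃ v, a v ≠ v := by
        by_contra! h
        exact ha (RelIso.ext h)
      refine ⟨max m v.length, ?_⟩
      rintro g (rfl | hg) h
      · exact absurd (mem_fixing_level_of_le (le_max_right _ _) h v rfl) hv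
      · exact hm g hg (mem_fixing_level_of_le (le_max_left _ _) h)

/-! ### The two subgroup induction properties -/

/-- The conclusion of the subgroup induction property for a single subgroup `H`. -/
def HasInducingTransversal (G H : Subgroup (TreeAut d)) : Prop :=
  ∃ X : Set (Vertex d), IsTransversal X ∧
    ∀ v ∈ X, sectionGroup v (stab H X) = ⊥ ∨
      (sectionGroup v (stab H X)).relIndex (sectionGroup v G) ≠ 0

theorem hasInducingTransversal_bot (G : Subgroup (TreeAut d)) : HasInducingTransversal G ⊥ := by
  refine ⟨{[]}, isTransversal_singleton_nil, fun v _ => Or.inl ?_⟩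
  rw [eq_bot_iff]
  intro x hx
  obtain ⟨g, hg, -, rfl⟩ := mem_sectionGroup.1 hx
  obtain rfl : g = 1 := hg.1
  exact (sectionHom v).map_one

theorem hasInducingTransversal_self (G : Subgroup (TreeAut d)) [NeZero d] :
    HasInducingTransversal G G :=
  ⟨{[]}, isTransversal_singleton_nil, fun v _ => Or.inr
    (relIndex_sectionGroup_ne_zero v (relIndex_stab_ne_zero G (Set.finite_singleton _)))⟩

theorem HasInducingTransversal.of_le {G H L : Subgroup (TreeAut d)}
    (hL : HasInducingTransversal G L) (h : H ≤ L) (hi : H.relIndex L ≠ 0) :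
    HasInducingTransversal G H := by
  obtain ⟨X, hX, hs⟩ := hL
  refine ⟨X, hX, fun v hv => (hs v hv).imp (fun h0 => ?_) fun h0 => ?_⟩
  · exact eq_bot_iff.2 ((sectionGroup_mono v (stab_mono h X)).trans h0.le)
  · exact Subgroup.relIndex_ne_zero_trans
      (relIndex_sectionGroup_ne_zero v (Subgroup.relIndex_inter_ne_zero hi _)) h0

theorem HasInducingTransversal.of_ge [NeZero d] {G H L : Subgroup (TreeAut d)}
    (hH : HasInducingTransversal G H) (h : H ≤ L) (hi : H.relIndex L ≠ 0) :
    HasInducingTransversal G L := by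
  obtain ⟨X, hX, hs⟩ := hH
  -- Where the section of H is trivial, that of L is merely finite: refine there to a level whose
  -- stabilizer meets this finite group trivially. Elsewhere the depth 0 keeps v itself.
  have key : ∀ v, ∃ m, (sectionGroup v (stab H X) = ⊥ →
      ∀ g ∈ sectionGroup v (stab L X), g ∈ fixing (level d m) → g = 1) ∧
      (sectionGroup v (stab H X) ≠ ⊥ → m = 0) := by
    intro v
    by_cases hv : sectionGroup v (stab H X) = ⊥
    · have hfin := relIndex_sectionGroup_ne_zero v
        (Subgroup.relIndex_inter_ne_zero hi (fixing X))
      change (sectionGroup v (stab H X)).relIndex (sectionGroup v (stab L X)) ≠ 0 at hfin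
      rw [hv, Subgroup.relIndex_bot_left] at hfin
      have : Finite (sectionGroup v (stab L X)) := Nat.finite_of_card_ne_zero hfin
      obtain ⟨m, hm⟩ := exists_forall_mem_fixing_level_imp_eq_one
        (S := (sectionGroup v (stab L X) : Set (TreeAut d))) (Set.toFinite _)
      exact ⟨m, fun _ => hm, fun h0 => absurd hv h0⟩
    · exact ⟨0, fun h0 => absurd h0 hv, fun _ => rfl⟩
  choose m hm hm0 using key
  have hY : ∀ v ∈ X, IsTransversal (level d (m v)) := fun v _ => isTransversal_level _
  have hle : stab L (refinement X fun v => level d (m v)) ≤ stab L X :=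
    inf_le_inf_left _ (fixing_refinement_le X hY)
  have hX' := hX.refinement hY
  refine ⟨_, hX', ?_⟩
  rintro _ ⟨v, hv, u, hu, rfl⟩
  by_cases hv0 : sectionGroup v (stab H X) = ⊥
  · left
    rw [eq_bot_iff]
    intro x hx
    obtain ⟨g, hg, -, rfl⟩ := mem_sectionGroup.1 hx
    have hgX : g ∈ stab L X := hle hg
    have hgv : g v = v := hgX.2 v hv
    have : treeSection v g = 1 := by
      refine hm v hv0 _ (mem_sectionGroup.2 ⟨g, hgX, hgv, rfl⟩) fun w hw => ?_
      exact (apply_append_eq_iff hgv).1 (hg.2 _ ⟨v, hv, w, hw, rfl⟩)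
    rw [treeSection_append, this]
    exact (sectionHom u).map_one
  · right
    obtain rfl : u = [] := by
      have hu' : u.length = m v := hu
      rwa [hm0 v hv0, List.length_eq_zero_iff] at hu'
    rw [List.append_nil]
    have h1 := (hs v hv).resolve_left hv0
    have h2 : (sectionGroup v (stab L X)).relIndex (sectionGroup v G) ≠ 0 := fun h0 =>
      h1 (Subgroup.relIndex_eq_zero_of_le_left (sectionGroup_mono v (stab_mono h X)) h0)
    refine Subgroup.relIndex_ne_zero_trans (relIndex_sectionGroup_ne_zero v ?_) h2
    exact fun h0 => relIndex_stab_ne_zero L hX'.finite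
      (Subgroup.relIndex_eq_zero_of_le_right inf_le_left h0)

theorem HasInducingTransversal.of_sections [NeZero d] {G H : Subgroup (TreeAut d)}
    (hG : IsSelfSimilar G)
    (h : ∀ v ∈ level d 1, HasInducingTransversal G (sectionGroup v H)) :
    HasInducingTransversal G H := by
  choose! Y hY hs using h
  have hX := (isTransversal_level (d := d) 1).refinement hY
  refine ⟨_, hX, ?_⟩
  rintro _ ⟨v, hv, u, hu, rfl⟩
  set X := refinement (level d 1) Y
  rw [sectionGroup_append, sectionGroup_append]
  have hle : sectionGroup v (stab H X) ≤ stab (sectionGroup v H) (Y v) := by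
    intro x hx
    obtain ⟨g, hg, hgv, rfl⟩ := mem_sectionGroup.1 hx
    refine ⟨mem_sectionGroup.2 ⟨g, hg.1, hgv, rfl⟩, fun w hw => ?_⟩
    exact (apply_append_eq_iff hgv).1 (hg.2 _ ⟨v, hv, w, hw, rfl⟩)
  -- Fixing all of X, not only the part below v, costs just a finite index because X is finite.
  have hi : (sectionGroup v (stab H X)).relIndex (stab (sectionGroup v H) (Y v)) ≠ 0 := fun h0 =>
    relIndex_sectionGroup_ne_zero v (relIndex_stab_ne_zero H hX.finite)
      (Subgroup.relIndex_eq_zero_of_le_right inf_le_left h0)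
  refine (hs v hv u hu).imp (fun h0 => ?_) fun h0 => ?_
  · exact eq_bot_iff.2 ((sectionGroup_mono u hle).trans h0.le)
  · have h1 := Subgroup.relIndex_ne_zero_trans (relIndex_sectionGroup_ne_zero u hi) h0
    -- Self-similarity makes φ_v(Stab_G(v)) a subgroup of G, so finite index in the section of G at
    -- u is enough.
    exact fun h2 => h1 (Subgroup.relIndex_eq_zero_of_le_right (sectionGroup_mono u (hG v)) h2)

theorem hasSubgroupInduction_iff {G : Subgroup (TreeAut d)} :
    HasSubgroupInduction G ↔ ∀ H ≤ G, H.FG → HasInducingTransversal G H := by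
  simp only [HasSubgroupInduction, HasInducingTransversal,
    Subgroup.isFiniteRelIndex_iff_relIndex_ne_zero]

/-- For self-similar groups, the subgroup induction property in terms of inductive classes
implies the one in terms of transversals. -/
theorem HasInductiveSubgroupInduction.hasSubgroupInduction [NeZero d] {G : Subgroup (TreeAut d)}
    (h : HasInductiveSubgroupInduction G) (hG : IsSelfSimilar G) : HasSubgroupInduction G := by
  rw [hasSubgroupInduction_iff]
  have hc : IsInductiveClass G {H | H ≤ G ∧ HasInducingTransversal G H} :=
    { le_of_mem := fun H hH => hH.1
      bot_mem := ⟨bot_le, hasInducingTransversal_bot G⟩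
      self_mem := ⟨le_rfl, hasInducingTransversal_self G⟩
      mem_iff_of_finiteIndex := fun H L hHL hLG hi =>
        ⟨fun hL => ⟨hHL.trans hLG, hL.2.of_le hHL hi.relIndex_ne_zero⟩,
          fun hH => ⟨hLG, hH.2.of_ge hHL hi.relIndex_ne_zero⟩⟩
      mem_of_sections := fun H hH _ hs =>
        ⟨hH.trans inf_le_left, .of_sections hG fun v hv => (hs v hv).2⟩ }
  exact fun H hH hfg => (h _ hc H hH hfg).2

/-! ### Torsion -/

/-- A vertex g v ≠ v of the same level would lie outside the subtree at v, hence be fixed by g,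
contradicting injectivity. -/
theorem apply_eq_self_of_mem_rist {G : Subgroup (TreeAut d)} {v : Vertex d} {g : TreeAut d}
    (hg : g ∈ rist G v) : g v = v := by
  have h : ¬ g v ≠ v := by
    intro h
    have h1 : ¬ v <+: g v := fun h2 => h (h2.eq_of_length (by simp)).symm
    have h2 := hg.2 (g v) h1
    exact h (g.injective h2)
  exact not_not.1 h

theorem rist_anti (G : Subgroup (TreeAut d)) {v w : Vertex d} (h : v <+: w) :
    rist G w ≤ rist G v :=
  stab_anti G fun _ hu hu' => hu (h.trans hu')

theorem eq_one_of_mem_rist_of_mem_rist {G : Subgroup (TreeAut d)} {v w : Vertex d}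
    (hl : v.length = w.length) (hne : v ≠ w) {g : TreeAut d} (hv : g ∈ rist G v)
    (hw : g ∈ rist G w) : g = 1 := by
  ext1 u
  by_cases hu : v <+: u
  · refine hw.2 u fun hu' => hne ?_
    exact (List.prefix_of_prefix_length_le hu hu' hl.le).eq_of_length hl
  · exact hv.2 u hu

/-- A virtually cyclic group does not contain two infinite subgroups with trivial intersection. -/
theorem false_of_isCyclic_of_relIndex_ne_zero {Γ : Type*} [Group Γ] {C K A B : Subgroup Γ}
    [IsCyclic C] (hC : C.relIndex K ≠ 0) (hA : A ≤ K) (hB : B ≤ K) [Infinite A] [Infinite B]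
    (hAB : Disjoint A B) : False := by
  obtain ⟨⟨c, hcC⟩, hc⟩ := IsCyclic.exists_generator (α := C)
  have hz : ∀ x ∈ C, ∃ i : ℤ, c ^ i = x := by
    intro x hx
    obtain ⟨i, hi⟩ := hc ⟨x, hx⟩
    exact ⟨i, congrArg Subtype.val hi⟩
  -- The intersection with C has finite index in D, so it is infinite as soon as D is.
  have key : ∀ D : Subgroup Γ, D ≤ K → Infinite D → Infinite (D ⊓ C : Subgroup Γ) := by
    intro D hD hDinf
    by_contra hfin
    rw [not_infinite_iff_finite] at hfin
    have h1 : (D ⊓ C).relIndex D ≠ 0 := by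
      rw [Subgroup.inf_relIndex_left]
      exact fun h0 => hC (Subgroup.relIndex_eq_zero_of_le_right hD h0)
    have h2 : (⊥ : Subgroup Γ).relIndex (D ⊓ C) ≠ 0 := by
      rw [Subgroup.relIndex_bot_left]
      exact Nat.card_pos.ne'
    have h3 := Subgroup.relIndex_ne_zero_trans h2 h1
    rw [Subgroup.relIndex_bot_left] at h3
    exact not_finite_iff_infinite.2 hDinf (Nat.finite_of_card_ne_zero h3)
  have key' : ∀ D : Subgroup Γ, D ≤ K → Infinite D → ∃ i : ℤ, i ≠ 0 ∧ c ^ i ∈ D := by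
    intro D hD hDinf
    have := key D hD hDinf
    obtain ⟨⟨x, hx⟩, hx1⟩ := exists_ne (1 : (D ⊓ C : Subgroup Γ))
    obtain ⟨i, rfl⟩ := hz x hx.2
    refine ⟨i, ?_, hx.1⟩
    rintro rfl
    exact hx1 (by ext; simp)
  obtain ⟨i, hi, hiA⟩ := key' A hA inferInstance
  obtain ⟨j, hj, hjB⟩ := key' B hB inferInstance
  -- This power lies in both A and B; so c has finite order, although C contains an infinite
  -- subgroup.
  have h1 : c ^ (i * j) = 1 := by
    refine Subgroup.disjoint_def.1 hAB ?_ ?_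
    · rw [zpow_mul]
      exact A.zpow_mem hiA j
    · rw [mul_comm, zpow_mul]
      exact B.zpow_mem hjB i
  have hfin : (Subgroup.zpowers c : Set Γ).Finite :=
    finite_zpowers.2 (isOfFinOrder_iff_zpow_eq_one.2 ⟨_, mul_ne_zero hi hj, h1⟩)
  have := key A hA inferInstance
  refine Set.infinite_coe_iff.1 this (hfin.subset ?_)
  rintro x ⟨-, hx⟩
  exact hz x hx

theorem isCyclic_sectionGroup (v : Vertex d) (H : Subgroup (TreeAut d)) [IsCyclic H] :
    IsCyclic (sectionGroup v H) := by
  have : IsCyclic (H.subgroupOf (fixing {v})) := by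
    refine isCyclic_of_injective (G' := H)
      (((fixing {v}).subtype.comp (H.subgroupOf (fixing {v})).subtype).codRestrict H
        fun x => x.2) ?_
    intro x y hxy
    have := congrArg Subtype.val hxy
    exact Subtype.ext (Subtype.ext this)
  exact isCyclic_of_surjective _ ((sectionHom v).subgroupMap_surjective _)

/-- An element supported below v is determined by its section at v. -/
theorem infinite_sectionGroup_rist {G : Subgroup (TreeAut d)} {v w : Vertex d} (h : v <+: w)
    (hinf : Infinite (rist G w)) : Infinite (sectionGroup v (rist G w)) := by
  refine Infinite.of_injective (fun g : rist G w => (⟨treeSection v g, mem_sectionGroup.2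
    ⟨g, g.2, apply_eq_self_of_mem_rist (rist_anti G h g.2), rfl⟩⟩ : sectionGroup v (rist G w))) ?_
  rintro ⟨a, ha⟩ ⟨b, hb⟩ hab
  have ha' := rist_anti G h ha
  have hb' := rist_anti G h hb
  have hav := apply_eq_self_of_mem_rist ha'
  have hbv := apply_eq_self_of_mem_rist hb'
  have e : treeSection v a = treeSection v b := congrArg Subtype.val hab
  rw [treeSection_eq_iff (hav.trans hbv.symm)] at e
  ext1
  ext1 u
  by_cases hu : v <+: u
  · obtain ⟨u, rfl⟩ := hu
    exact e u
  · exact (ha'.2 u hu).trans (hb'.2 u hu).symm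

theorem IsWeaklyBranch.not_isCyclic_section (hd : 2 ≤ d) {G : Subgroup (TreeAut d)}
    (hG : IsWeaklyBranch G) (v : Vertex d) (C : Subgroup (TreeAut d)) [IsCyclic C]
    (hC : C.relIndex (sectionGroup v G) ≠ 0) : False := by
  let a : Fin d := ⟨0, by omega⟩
  let b : Fin d := ⟨1, by omega⟩
  have hab : v ++ [a] ≠ v ++ [b] := by simp [a, b]
  have hpa : v <+: v ++ [a] := List.prefix_append _ _
  have hpb : v <+: v ++ [b] := List.prefix_append _ _
  have := infinite_sectionGroup_rist hpa (hG.infinite_rist _)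
  have := infinite_sectionGroup_rist hpb (hG.infinite_rist _)
  refine false_of_isCyclic_of_relIndex_ne_zero (A := sectionGroup v (rist G (v ++ [a])))
    (B := sectionGroup v (rist G (v ++ [b]))) hC
    (sectionGroup_mono v inf_le_left)
    (sectionGroup_mono v inf_le_left) ?_
  rw [Subgroup.disjoint_def]
  intro x hx hy
  obtain ⟨g, hg, hgv, rfl⟩ := mem_sectionGroup.1 hx
  obtain ⟨h, hh, hhv, hgh⟩ := mem_sectionGroup.1 hy
  have e : h = g := by
    rw [treeSection_eq_iff (hhv.trans hgv.symm)] at hgh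
    ext1 u
    by_cases hu : v <+: u
    · obtain ⟨u, rfl⟩ := hu
      exact hgh u
    · exact ((rist_anti G hpb hh).2 u hu).trans ((rist_anti G hpa hg).2 u hu).symm
  rw [e] at hh
  rw [eq_one_of_mem_rist_of_mem_rist (by simp) hab hg hh]
  exact (sectionHom v).map_one

/-- A group acting with trivial sections along a transversal is finite. -/
theorem IsTransversal.finite_of_sectionGroup_eq_bot [NeZero d] {X : Set (Vertex d)}
    (hX : IsTransversal X) {H : Subgroup (TreeAut d)}
    (h : ∀ v ∈ X, sectionGroup v (stab H X) = ⊥) : Finite H := by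
  have h1 : stab H X = ⊥ := by
    rw [eq_bot_iff]
    intro g hg
    refine hX.eq_one hg.2 fun v hv => ?_
    have : treeSection v g ∈ sectionGroup v (stab H X) :=
      mem_sectionGroup.2 ⟨g, hg, hg.2 v hv, rfl⟩
    rwa [h v hv] at this
  have h2 := relIndex_stab_ne_zero H hX.finite
  rw [h1, Subgroup.relIndex_bot_left] at h2
  exact Nat.finite_of_card_ne_zero h2

theorem IsWeaklyBranch.isMulTorsion (hd : 2 ≤ d) {G : Subgroup (TreeAut d)}
    (hG : IsWeaklyBranch G) (hsi : HasSubgroupInduction G) : IsMulTorsion G := by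
  have : NeZero d := ⟨by omega⟩
  rintro ⟨g, hg⟩
  rw [hasSubgroupInduction_iff] at hsi
  obtain ⟨X, hX, hs⟩ := hsi (Subgroup.zpowers g) (by simpa using hg)
    ⟨{g}, by rw [Finset.coe_singleton, Subgroup.zpowers_eq_closure]⟩
  have hfin : Finite (Subgroup.zpowers g) := by
    refine hX.finite_of_sectionGroup_eq_bot fun v hv => (hs v hv).resolve_right fun h => ?_
    have : IsCyclic (stab (Subgroup.zpowers g) X) :=
      isCyclic_of_injective (Subgroup.inclusion inf_le_left) (Subgroup.inclusion_injective _)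
    have := isCyclic_sectionGroup v (stab (Subgroup.zpowers g) X)
    exact hG.not_isCyclic_section hd v _ h
  have hg' : IsOfFinOrder g := finite_zpowers.1 (Set.toFinite _)
  exact (Submonoid.isOfFinOrder_coe (x := (⟨g, hg⟩ : G))).1 hg'

/-! ### Just infiniteness -/

theorem conj_mem_rist {G : Subgroup (TreeAut d)} {v : Vertex d} {a g : TreeAut d}
    (ha : a ∈ rist G v) (hg : g ∈ G) : g * a * g⁻¹ ∈ rist G (g v) := by
  refine ⟨G.mul_mem (G.mul_mem hg ha.1) (G.inv_mem hg), fun w hw => ?_⟩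
  have h : ¬ v <+: g⁻¹ w := by
    intro h
    have := g.map_rel_iff.2 h
    rw [RelIso.apply_inv_self] at this
    exact hw this
  rw [RelIso.mul_apply, RelIso.mul_apply, ha.2 _ h, RelIso.apply_inv_self]

theorem prefix_apply_iff {v w : Vertex d} {g : TreeAut d} (hg : g v = v) :
    v <+: g w ↔ v <+: w := by
  have := g.map_rel_iff (a := v) (b := w)
  rwa [hg] at this

/-- An automorphism fixing the subtree at `v` commutes with those supported on that subtree. -/
theorem commute_of_mem_rist {G : Subgroup (TreeAut d)} {v : Vertex d} {a b : TreeAut d}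
    (ha : a ∈ rist G v) (hb : ∀ w, v <+: w → b w = w) : a * b = b * a := by
  have hav := apply_eq_self_of_mem_rist ha
  have hbv := hb v List.prefix_rfl
  ext1 u
  rw [RelIso.mul_apply, RelIso.mul_apply]
  by_cases hu : v <+: u
  · rw [hb u hu, hb (a u) ((prefix_apply_iff hav).2 hu)]
  · rw [ha.2 u hu, ha.2 (b u) fun h => hu ((prefix_apply_iff hbv).1 h)]

theorem commute_of_mem_rist_of_mem_rist {G : Subgroup (TreeAut d)} {v w : Vertex d}
    (hl : v.length = w.length) (hne : v ≠ w) {a b : TreeAut d} (ha : a ∈ rist G v)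
    (hb : b ∈ rist G w) : a * b = b * a :=
  commute_of_mem_rist ha fun _ hu => hb.2 _ fun hu' =>
    hne ((List.prefix_of_prefix_length_le hu hu' hl.le).eq_of_length hl)

theorem exists_apply_ne {g : TreeAut d} (hg : g ≠ 1) : ∃ v, g v ≠ v := by
  by_contra! h
  exact hg (RelIso.ext h)

theorem finite_of_finite_subgroup {Γ : Type*} [Group Γ] (K : Subgroup Γ) [Finite K]
    [K.FiniteIndex] : Finite Γ := by
  refine Nat.finite_of_card_ne_zero ?_
  rw [← K.card_mul_index]
  exact mul_ne_zero Nat.card_pos.ne' Subgroup.FiniteIndex.index_ne_zero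

/-- The image of the closure of S is abelian, torsion, and finitely generated as an image of a
finite index subgroup of Γ. Hence it is finite, and it has finite index in the quotient. -/
theorem finite_quotient_of_commute {Γ : Type*} [Group Γ] [Group.FG Γ] (ht : IsMulTorsion Γ)
    {N : Subgroup Γ} [N.Normal] {S : Set Γ} [(Subgroup.closure S).FiniteIndex]
    (hcomm : ∀ a ∈ S, ∀ b ∈ S, QuotientGroup.mk' N a * QuotientGroup.mk' N b =
      QuotientGroup.mk' N b * QuotientGroup.mk' N a) : Finite (Γ ⧸ N) := by
  let q := QuotientGroup.mk' N
  have hfgQ : Group.FG ((Subgroup.closure S).map q) :=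
    Group.fg_of_surjective (q.subgroupMap_surjective _)
  have hc : IsMulCommutative ((Subgroup.closure S).map q) := by
    rw [MonoidHom.map_closure]
    apply Subgroup.isMulCommutative_closure
    rintro _ ⟨a, ha, rfl⟩ _ ⟨b, hb, rfl⟩
    exact hcomm a ha b hb
  have htQ : IsMulTorsion ((Subgroup.closure S).map q) := by
    rintro ⟨_, a, -, rfl⟩
    exact Submonoid.isOfFinOrder_coe.1 (q.isOfFinOrder (ht a))
  let _ : CommGroup ((Subgroup.closure S).map q) := { mul_comm := hc.is_comm.comm }
  have : Finite ((Subgroup.closure S).map q) := CommGroup.finite_of_fg_isMulTorsion _ htQ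
  have : ((Subgroup.closure S).map q).FiniteIndex := by
    refine ⟨fun h0 => Subgroup.FiniteIndex.index_ne_zero (H := Subgroup.closure S) ?_⟩
    have := Subgroup.index_map_dvd (Subgroup.closure S) (QuotientGroup.mk'_surjective N)
    rw [h0] at this
    exact zero_dvd_iff.1 this
  exact finite_of_finite_subgroup ((Subgroup.closure S).map q)

/-- A finitely generated torsion branch group is just infinite. -/
theorem IsBranch.isJustInfinite {G : Subgroup (TreeAut d)} (hG : IsBranch G) (hfg : Group.FG G)
    (ht : IsMulTorsion G) : IsJustInfinite G := by
  refine ⟨?_, fun N hN hN0 => ?_⟩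
  · have := hG.infinite_rist []
    exact Infinite.of_injective (fun a : rist G [] => (⟨a, a.2.1⟩ : G)) fun a b h =>
      Subtype.ext (Subtype.mk.inj h)
  obtain ⟨g, hgN, hg1⟩ := N.bot_or_exists_ne_one.resolve_left hN0
  obtain ⟨x, hx⟩ : ∃ x, (g : TreeAut d) x ≠ x :=
    exists_apply_ne fun h => hg1 (Subtype.ext h)
  let q := QuotientGroup.mk' N
  have hmove : ∀ w ∈ level d x.length, ∃ k ∈ N, (k : TreeAut d) w ≠ w := by
    intro w hw
    obtain ⟨k, hk, rfl⟩ := hG.transitive _ x rfl w hw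
    refine ⟨⟨k, hk⟩ * g * ⟨k, hk⟩⁻¹, hN.conj_mem _ hgN _, fun h => hx ?_⟩
    have h' : k ((g : TreeAut d) (k⁻¹ (k x))) = k x := h
    rw [RelIso.inv_apply_self] at h'
    exact k.injective h'
  let S : Set G := {a | ∃ w ∈ level d x.length, (a : TreeAut d) ∈ rist G w}
  have hcomm : ∀ a ∈ S, ∀ b ∈ S, q a * q b = q b * q a := by
    rintro a ⟨v, hv, ha⟩ b ⟨w, hw, hb⟩
    have hl : v.length = w.length := Eq.trans hv (Eq.symm hw)
    by_cases hvw : v = w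
    · subst hvw
      obtain ⟨k, hk, hkv⟩ := hmove v hv
      -- The conjugate is supported below k v ≠ v, so it commutes with b; modulo N it equals a.
      have h1 : k * a * k⁻¹ * b = b * (k * a * k⁻¹) := Subtype.ext
        (commute_of_mem_rist_of_mem_rist (by simp) hkv (conj_mem_rist ha k.2) hb)
      have hqk : q k = 1 := (QuotientGroup.eq_one_iff k).2 hk
      have h2 := congrArg q h1
      simpa [hqk] using h2
    · rw [← map_mul, ← map_mul]
      exact congrArg q (Subtype.ext (commute_of_mem_rist_of_mem_rist hl hvw ha hb))
  have hle : (ristLevel G x.length).subgroupOf G ≤ Subgroup.closure S := by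
    have h1 : ristLevel G x.length ≤ (Subgroup.closure S).map G.subtype := by
      refine iSup₂_le fun w hw a ha => ?_
      exact ⟨⟨a, ha.1⟩, Subgroup.subset_closure ⟨w, hw, ha⟩, rfl⟩
    intro a ha
    obtain ⟨b, hb, hba⟩ := h1 ha
    obtain rfl : b = a := Subtype.ext hba
    exact hb
  have : (Subgroup.closure S).FiniteIndex := by
    have := hG.finiteIndex_ristLevel x.length
    exact Subgroup.finiteIndex_of_le hle
  exact finite_quotient_of_commute ht hcomm

/-- The finite index property of normal subgroups of a just infinite group, for subgroups of the
ambient group. -/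
theorem IsJustInfinite.relIndex_ne_zero {Γ : Type*} [Group Γ] {G : Subgroup Γ}
    (h : IsJustInfinite G) {N : Subgroup Γ} (hNG : N ≤ G)
    (hN : ∀ n ∈ N, ∀ g ∈ G, g * n * g⁻¹ ∈ N) (hN0 : N ≠ ⊥) : N.relIndex G ≠ 0 := by
  have hn : (N.subgroupOf G).Normal := ⟨fun n hn g => hN n hn g g.2⟩
  have := h.2 (N.subgroupOf G) hn (by
    rw [Ne, Subgroup.subgroupOf_eq_bot]
    intro hd
    exact hN0 (hd.eq_bot_of_le hNG))
  exact (Subgroup.finiteIndex_of_finite_quotient (H := N.subgroupOf G)).index_ne_zero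

/-! ### Prodense subgroups -/

/-- `H U = G` for all subgroups `U` of finite index in `G`. -/
def IsProdense {Γ : Type*} [Group Γ] (G H : Subgroup Γ) : Prop :=
  ∀ U : Subgroup Γ, U.relIndex G ≠ 0 → ∀ g ∈ G, ∃ h ∈ H, ∃ u ∈ U, h * u = g

/-- The automorphisms that fix `w` and agree on the subtree at `w` with an element of `K`. -/
def sectionPreimage (w : Vertex d) (K : Subgroup (TreeAut d)) : Subgroup (TreeAut d) :=
  ((sectionGroup w K).comap (sectionHom w)).map (fixing {w}).subtype

theorem mem_sectionPreimage {w : Vertex d} {K : Subgroup (TreeAut d)} {g : TreeAut d} :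
    g ∈ sectionPreimage w K ↔ g w = w ∧ ∃ c ∈ K, c w = w ∧ treeSection w c = treeSection w g := by
  constructor
  · rintro ⟨⟨g, hg⟩, hgK, rfl⟩
    exact ⟨mem_fixing_singleton.1 hg, mem_sectionGroup.1 hgK⟩
  · rintro ⟨hg, hc⟩
    exact ⟨⟨g, mem_fixing_singleton.2 hg⟩, mem_sectionGroup.2 hc, rfl⟩

/-- This turns a finite index statement about sections into one about G, to which prodensity can be
applied. -/
theorem relIndex_sectionPreimage_of_sectionGroup {w : Vertex d} {G K : Subgroup (TreeAut d)}
    (h : (sectionGroup w K).relIndex (sectionGroup w G) ≠ 0) :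
    (sectionPreimage w K).relIndex G ≠ 0 := by
  have h1 : ((sectionGroup w K).comap (sectionHom w)).relIndex (G.subgroupOf (fixing {w})) ≠ 0 := by
    rw [Subgroup.relIndex_comap]
    exact h
  have h2 := relIndex_map_ne_zero (fixing {w}).subtype h1
  rw [Subgroup.subgroupOf_map_subtype] at h2
  exact Subgroup.relIndex_ne_zero_trans h2 (relIndex_stab_ne_zero G (Set.finite_singleton w))

theorem relIndex_sectionPreimage_sectionPreimage {H K : Subgroup (TreeAut d)} (w : Vertex d)
    (h : K.relIndex H ≠ 0) : (sectionPreimage w K).relIndex (sectionPreimage w H) ≠ 0 :=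
  relIndex_map_ne_zero _ (Subgroup.relIndex_comap_ne_zero _ (relIndex_sectionGroup_ne_zero w h))

theorem treeSection_mul {v : Vertex d} {a b : TreeAut d} (ha : a v = v) (hb : b v = v) :
    treeSection v (a * b) = treeSection v a * treeSection v b :=
  (sectionHom v).map_mul ⟨a, mem_fixing_singleton.2 ha⟩ ⟨b, mem_fixing_singleton.2 hb⟩

theorem treeSection_inv {v : Vertex d} {a : TreeAut d} (ha : a v = v) :
    treeSection v a⁻¹ = (treeSection v a)⁻¹ :=
  (sectionHom v).map_inv ⟨a, mem_fixing_singleton.2 ha⟩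

theorem inv_apply_eq_self {v : Vertex d} {a : TreeAut d} (ha : a v = v) : a⁻¹ v = v :=
  mem_fixing_singleton.1 ((fixing {v}).inv_mem (mem_fixing_singleton.2 ha))

theorem mul_apply_eq_self {v : Vertex d} {a b : TreeAut d} (ha : a v = v) (hb : b v = v) :
    (a * b) v = v := by
  rw [RelIso.mul_apply, hb, ha]

theorem treeSection_commutator {v : Vertex d} {a b : TreeAut d} (ha : a v = v) (hb : b v = v) :
    treeSection v ⁅a, b⁆ = ⁅treeSection v a, treeSection v b⁆ := by
  have ha' := inv_apply_eq_self ha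
  have hb' := inv_apply_eq_self hb
  have hab := mul_apply_eq_self ha hb
  rw [commutatorElement_def, commutatorElement_def,
    treeSection_mul (mul_apply_eq_self hab ha') hb', treeSection_mul hab ha', treeSection_mul ha hb,
    treeSection_inv ha, treeSection_inv hb]

theorem treeSection_conj {v : Vertex d} {h a : TreeAut d} (ha : a v = v) :
    treeSection (h v) (h * a * h⁻¹) = treeSection v h * treeSection v a * (treeSection v h)⁻¹ := by
  ext1 u
  have h1 := apply_append v h ((treeSection v h)⁻¹ u)
  rw [RelIso.apply_inv_self] at h1
  have h2 : h⁻¹ (h v ++ u) = v ++ (treeSection v h)⁻¹ u := by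
    rw [← h1, RelIso.inv_apply_self]
  have hfix : (h * a * h⁻¹) (h v) = h v := by
    rw [RelIso.mul_apply, RelIso.mul_apply, RelIso.inv_apply_self, ha]
  have h3 := apply_append (h v) (h * a * h⁻¹) u
  rw [hfix, RelIso.mul_apply, RelIso.mul_apply, h2, apply_append v a, ha, apply_append v h] at h3
  exact (List.append_cancel_left h3).symm

/-- Conjugation by h preserves G and, as h lies in H, carries the preimage at v into the one at h v.
-/
theorem relIndex_sectionPreimage_apply {G H : Subgroup (TreeAut d)} (hHG : H ≤ G) {h : TreeAut d}
    (hh : h ∈ H) {v : Vertex d} (hv : (sectionPreimage v H).relIndex G ≠ 0) :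
    (sectionPreimage (h v) H).relIndex G ≠ 0 := by
  have h1 := relIndex_map_ne_zero (MulAut.conj h).toMonoidHom hv
  have hG : G.map (MulAut.conj h).toMonoidHom = G := by
    ext x
    constructor
    · rintro ⟨y, hy, rfl⟩
      exact G.mul_mem (G.mul_mem (hHG hh) hy) (G.inv_mem (hHG hh))
    · intro hx
      refine ⟨h⁻¹ * x * h, G.mul_mem (G.mul_mem (G.inv_mem (hHG hh)) hx) (hHG hh), ?_⟩
      simp [mul_assoc]
  rw [hG] at h1
  refine fun h0 => h1 (Subgroup.relIndex_eq_zero_of_le_left ?_ h0)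
  rintro _ ⟨a, ha, rfl⟩
  obtain ⟨hav, c, hc, hcv, hca⟩ := mem_sectionPreimage.1 ha
  refine mem_sectionPreimage.2 ⟨?_, h * c * h⁻¹, H.mul_mem (H.mul_mem hh hc) (H.inv_mem hh), ?_, ?_⟩
  · simp [hav]
  · simp [hcv]
  · change _ = treeSection (h v) (h * a * h⁻¹)
    rw [treeSection_conj hav, treeSection_conj hcv, hca]

theorem normal_fixing_level (n : ℕ) : (fixing (level d n)).Normal := by
  refine ⟨fun a ha g v hv => ?_⟩
  have hv' : g⁻¹ v ∈ level d n := Eq.trans (length_apply g⁻¹ v) hv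
  rw [RelIso.mul_apply, RelIso.mul_apply, ha _ hv', RelIso.apply_inv_self]

/-- The vertices of level `n` below which `s` acts nontrivially. -/
def levelSupport (n : ℕ) (s : TreeAut d) : Set (Vertex d) :=
  {w | w ∈ level d n ∧ treeSection w s ≠ 1}

theorem finite_levelSupport (n : ℕ) (s : TreeAut d) : (levelSupport n s).Finite :=
  (finite_level d n).subset fun _ h => h.1

theorem mem_rist_of_levelSupport_subset [NeZero d] {n : ℕ} {H : Subgroup (TreeAut d)}
    {s : TreeAut d} (hs : s ∈ stab H (level d n)) {w : Vertex d} (h : levelSupport n s ⊆ {w}) :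
    s ∈ rist H w := by
  refine ⟨hs.1, fun u hu => ?_⟩
  obtain hn | hn := le_total u.length n
  · exact mem_fixing_level_of_le hn hs.2 u rfl
  · have hlen : u.take n ∈ level d n := by simp [level, hn]
    have h1 : treeSection (u.take n) s = 1 := by
      by_contra h1
      have : u.take n = w := h ⟨hlen, h1⟩
      exact hu (this ▸ List.take_prefix n u)
    have h2 := (treeSection_eq_one_iff (hs.2 _ hlen)).1 h1 (u.drop n)
    rwa [List.take_append_drop] at h2

theorem levelSupport_nonempty {n : ℕ} [NeZero d] {s : TreeAut d} (hs : s ∈ fixing (level d n))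
    (h1 : s ≠ 1) : (levelSupport n s).Nonempty := by
  by_contra h
  rw [Set.not_nonempty_iff_eq_empty] at h
  refine h1 ((isTransversal_level n).eq_one hs fun v hv => ?_)
  by_contra hne
  have : v ∈ levelSupport n s := ⟨hv, hne⟩
  rw [h] at this
  exact this

theorem mem_fixing_level_of_mem_rist {G : Subgroup (TreeAut d)} {w : Vertex d} {g : TreeAut d}
    (hg : g ∈ rist G w) : g ∈ fixing (level d w.length) := by
  intro v hv
  by_cases h : w <+: v
  · obtain rfl := h.eq_of_length (Eq.symm hv)
    exact apply_eq_self_of_mem_rist hg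
  · exact hg.2 v h

/-- If s moves a vertex below w, a nontrivial element of the rigid stabilizer of that vertex cannot
commute with s: its support would also lie below the image vertex. -/
theorem IsWeaklyBranch.exists_commutator_ne_one {G : Subgroup (TreeAut d)} (hG : IsWeaklyBranch G)
    {w : Vertex d} {s : TreeAut d} (hsw : s w = w) (hs : treeSection w s ≠ 1) :
    ∃ g ∈ rist G w, ⁅g, s⁆ ≠ 1 := by
  obtain ⟨u, hu⟩ : ∃ u, s (w ++ u) ≠ w ++ u := by
    by_contra! h
    exact hs ((treeSection_eq_one_iff hsw).2 h)
  have := hG.infinite_rist (w ++ u)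
  obtain ⟨⟨g, hg⟩, hg1⟩ := exists_ne (1 : rist G (w ++ u))
  refine ⟨g, rist_anti G (List.prefix_append w u) hg, fun h => hg1 ?_⟩
  rw [commutatorElement_eq_one_iff_mul_comm] at h
  have h1 : s * g * s⁻¹ = g := by rw [← h, mul_inv_cancel_right]
  have hg' : g ∈ rist ⊤ (w ++ u) := ⟨trivial, hg.2⟩
  have h2 := conj_mem_rist (g := s) hg' trivial
  rw [h1] at h2
  exact Subtype.ext (eq_one_of_mem_rist_of_mem_rist (by simp) hu h2 hg')

/-- A prodense subgroup whose sections on level `n` have finite index contains a nontrivial element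
supported below a single vertex of level `n`. -/
theorem IsWeaklyBranch.exists_mem_rist_of_isProdense [NeZero d] {G H : Subgroup (TreeAut d)}
    (hG : IsWeaklyBranch G) (hH : IsProdense G H) {n : ℕ}
    (hn : ∀ w ∈ level d n, (sectionPreimage w H).relIndex G ≠ 0) (hS : stab H (level d n) ≠ ⊥) :
    ∃ w ∈ level d n, ∃ s ∈ rist H w, s ≠ 1 := by
  obtain ⟨s₀, hs₀, hs₀1⟩ := (Subgroup.bot_or_exists_ne_one _).resolve_left hS
  -- Take s with as few active vertices on level n as possible. Given a second active vertex w', a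
  -- nontrivial element inactive at w' will be built from s.
  obtain ⟨s, ⟨hs, hs1⟩, hmin⟩ := (measure fun s : TreeAut d => (levelSupport n s).ncard).wf.has_min
    {s | s ∈ stab H (level d n) ∧ s ≠ 1} ⟨s₀, hs₀, hs₀1⟩
  obtain ⟨w, hw, hws⟩ := levelSupport_nonempty hs.2 hs1
  refine ⟨w, hw, s, mem_rist_of_levelSupport_subset hs ?_, hs1⟩
  intro w' hw'
  by_contra hne
  obtain ⟨g, hg, hgs⟩ := hG.exists_commutator_ne_one (hs.2 w hw) hws
  obtain ⟨m₀, hm₀⟩ := exists_forall_mem_fixing_level_imp_eq_one (Set.finite_singleton ⁅g, s⁆)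
  obtain ⟨m, hm, hnm⟩ : ∃ m, m₀ ≤ m ∧ n ≤ m := ⟨_, le_max_left _ _, le_max_right _ _⟩
  have hm' : ⁅g, s⁆ ∉ fixing (level d m) := fun h =>
    hgs (hm₀ _ rfl (mem_fixing_level_of_le hm h))
  -- Approximate g by h ∈ H up to an error u that is invisible on level m and agrees below w' with
  -- some c ∈ H, also invisible on level m.
  have hU : (sectionPreimage w' (stab H (level d m)) ⊓ fixing (level d m)).relIndex G ≠ 0 := by
    refine Subgroup.relIndex_inf_ne_zero (Subgroup.relIndex_ne_zero_trans
      (relIndex_sectionPreimage_sectionPreimage w' (relIndex_stab_ne_zero H (finite_level d m)))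
      (hn w' hw'.1)) ?_
    have := finiteIndex_fixing (finite_level d m)
    exact (Subgroup.isFiniteRelIndex_of_finiteIndex (K := G)).relIndex_ne_zero
  obtain ⟨h, hh, u, hu, hgu⟩ := hH _ hU g hg.1
  obtain ⟨c, hc, hcw', hcu⟩ := (mem_sectionPreimage.1 hu.1).2
  obtain rfl : h = g * u⁻¹ := by rw [← hgu, mul_inv_cancel_right]
  have hgn : g ∈ fixing (level d n) := by
    have hw0 : w.length = n := hw
    exact hw0 ▸ mem_fixing_level_of_mem_rist hg
  have hun : u ∈ fixing (level d n) := mem_fixing_level_of_le hnm hu.2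
  have hcn : c⁻¹ ∈ stab H (level d n) :=
    inv_mem (show c ∈ stab H (level d n) from ⟨hc.1, mem_fixing_level_of_le hnm hc.2⟩)
  have hhn : g * u⁻¹ ∈ stab H (level d n) := ⟨hh, (fixing _).mul_mem hgn ((fixing _).inv_mem hun)⟩
  have hcomm : ∀ {a b : TreeAut d}, a ∈ stab H (level d n) → b ∈ stab H (level d n) →
      ⁅a, b⁆ ∈ stab H (level d n) := fun ha hb =>
    mul_mem (mul_mem (mul_mem ha hb) (inv_mem ha)) (inv_mem hb)
  have h1 := hcomm hhn hs
  have h2 := hcomm hcn hs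
  -- Since g is trivial below w', the elements h = g u⁻¹ and c⁻¹ have the same section there, so the
  -- two commutators cancel at w'.
  have hsec : ∀ v ∈ level d n, treeSection v (⁅g * u⁻¹, s⁆ * ⁅c⁻¹, s⁆⁻¹) =
      ⁅treeSection v (g * u⁻¹), treeSection v s⁆ * ⁅treeSection v c⁻¹, treeSection v s⁆⁻¹ := by
    intro v hv
    rw [treeSection_mul (h1.2 v hv) (inv_apply_eq_self (h2.2 v hv)), treeSection_inv (h2.2 v hv),
      treeSection_commutator (hhn.2 v hv) (hs.2 v hv),
      treeSection_commutator (hcn.2 v hv) (hs.2 v hv)]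
  have hsub : levelSupport n (⁅g * u⁻¹, s⁆ * ⁅c⁻¹, s⁆⁻¹) ⊆ levelSupport n s := by
    rintro v ⟨hv, hv1⟩
    refine ⟨hv, fun h0 => hv1 ?_⟩
    rw [hsec v hv, h0, commutatorElement_one_right, commutatorElement_one_right, inv_one, mul_one]
  have hw'0 : w' ∉ levelSupport n (⁅g * u⁻¹, s⁆ * ⁅c⁻¹, s⁆⁻¹) := by
    rintro ⟨hv, hv1⟩
    refine hv1 ?_
    have hgw' : treeSection w' g = 1 := by
      rw [treeSection_eq_one_iff (hgn w' hv)]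
      intro x
      refine hg.2 _ fun hx => hne ?_
      have hl : w.length = w'.length := Eq.trans hw (Eq.symm hv)
      exact ((List.prefix_of_prefix_length_le hx (List.prefix_append w' x)
        hl.le).eq_of_length hl).symm
    rw [hsec w' hv, treeSection_mul (hgn w' hv) (inv_apply_eq_self (hun w' hv)), hgw', one_mul,
      treeSection_inv (hun w' hv), treeSection_inv hcw', hcu, mul_inv_cancel]
  have ht : ⁅g * u⁻¹, s⁆ * ⁅c⁻¹, s⁆⁻¹ = 1 := by
    by_contra ht
    refine hmin _ ⟨mul_mem h1 (inv_mem h2), ht⟩ ?_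
    exact Set.ncard_lt_ncard (Set.ssubset_iff_of_subset hsub |>.2 ⟨w', hw', hw'0⟩)
      (finite_levelSupport n s)
  -- Minimality forced the product to be 1; but modulo the stabilizer of level m both u and c
  -- vanish, leaving ⁅g, s⁆, which is nontrivial there.
  have := normal_fixing_level (d := d) m
  have hq := congrArg (QuotientGroup.mk' (fixing (level d m))) (mul_inv_eq_one.1 ht)
  have hqu : QuotientGroup.mk' (fixing (level d m)) u = 1 := (QuotientGroup.eq_one_iff u).2 hu.2
  have hqc : QuotientGroup.mk' (fixing (level d m)) c = 1 := (QuotientGroup.eq_one_iff c).2 hc.2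
  rw [map_commutatorElement, map_commutatorElement, map_mul, map_inv, map_inv, hqu, hqc, inv_one,
    mul_one, commutatorElement_one_left, ← map_commutatorElement] at hq
  exact hm' ((QuotientGroup.eq_one_iff _).1 hq)

/-- A finite prodense subgroup is the whole group. -/
theorem IsProdense.le_of_finite [NeZero d] {G H : Subgroup (TreeAut d)} (hH : IsProdense G H)
    [Finite H] : G ≤ H := by
  intro g hg
  -- The depth m separates g from the finitely many elements of H different from g.
  obtain ⟨m, hm⟩ := exists_forall_mem_fixing_level_imp_eq_one
    (Set.finite_range fun h : H => (h : TreeAut d)⁻¹ * g)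
  have := finiteIndex_fixing (finite_level d m)
  obtain ⟨h, hh, u, hu, rfl⟩ := hH (fixing (level d m))
    (Subgroup.isFiniteRelIndex_of_finiteIndex (K := G)).relIndex_ne_zero g hg
  have hu1 : u = 1 := hm u ⟨⟨h, hh⟩, by simp⟩ hu
  rwa [hu1, mul_one]

theorem IsProdense.exists_apply_eq {G H : Subgroup (TreeAut d)} (hG : IsWeaklyBranch G)
    (hH : IsProdense G H) {v w : Vertex d} (hvw : v.length = w.length) : ∃ h ∈ H, h v = w := by
  obtain ⟨g, hg, rfl⟩ := hG.transitive w.length v hvw w rfl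
  have := finiteIndex_fixing_singleton v
  obtain ⟨h, hh, u, hu, rfl⟩ := hH (fixing {v})
    (Subgroup.isFiniteRelIndex_of_finiteIndex (K := G)).relIndex_ne_zero g hg
  exact ⟨h, hh, by rw [RelIso.mul_apply, hu v rfl]⟩

/-- In a just infinite weakly branch group, a prodense subgroup to which the conclusion of the
subgroup induction property applies is the whole group. -/
theorem IsProdense.le_of_hasInducingTransversal [NeZero d] {G H : Subgroup (TreeAut d)}
    (hG : IsWeaklyBranch G) (hji : IsJustInfinite G) (hHG : H ≤ G) (hH : IsProdense G H)
    (hX : HasInducingTransversal G H) : G ≤ H := by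
  obtain ⟨X, hX, hs⟩ := hX
  by_cases hall : ∀ v ∈ X, sectionGroup v (stab H X) = ⊥
  · have := hX.finite_of_sectionGroup_eq_bot hall
    exact hH.le_of_finite
  push Not at hall
  obtain ⟨v, hv, hv0⟩ := hall
  have hvH : (sectionPreimage v H).relIndex G ≠ 0 := by
    refine relIndex_sectionPreimage_of_sectionGroup fun h0 => (hs v hv).resolve_left hv0 ?_
    exact Subgroup.relIndex_eq_zero_of_le_left (sectionGroup_mono v inf_le_left) h0
  have hn : ∀ w ∈ level d v.length, (sectionPreimage w H).relIndex G ≠ 0 := by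
    intro w hw
    obtain ⟨h, hh, rfl⟩ := hH.exists_apply_eq hG (Eq.symm hw)
    exact relIndex_sectionPreimage_apply hHG hh hvH
  by_cases hS : stab H (level d v.length) = ⊥
  · have h2 := relIndex_stab_ne_zero H (finite_level d v.length)
    rw [hS, Subgroup.relIndex_bot_left] at h2
    have := Nat.finite_of_card_ne_zero h2
    exact hH.le_of_finite
  obtain ⟨w, hw, s, hsw, hs1⟩ := hG.exists_mem_rist_of_isProdense hH hn hS
  -- Write g = h a with a agreeing below w with some c ∈ H. As s lives below w, conjugating it by a
  -- or by c gives the same element of H.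
  have hconj : ∀ g ∈ G, g * s * g⁻¹ ∈ H := by
    intro g hg
    obtain ⟨h, hh, a, ha, rfl⟩ := hH _ (hn w hw) g hg
    obtain ⟨haw, c, hc, hcw, hca⟩ := mem_sectionPreimage.1 ha
    have hfix : ∀ u, w <+: u → (c⁻¹ * a) u = u := by
      rintro _ ⟨u, rfl⟩
      rw [RelIso.mul_apply, ← (treeSection_eq_iff (hcw.trans haw.symm)).1 hca u,
        RelIso.inv_apply_self]
    have hcomm := commute_of_mem_rist hsw hfix
    have e : h * a * s * (h * a)⁻¹ = h * (c * s * c⁻¹) * h⁻¹ := by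
      have : a * s = c * s * c⁻¹ * a := by
        calc a * s = c * (c⁻¹ * a * s) := by group
          _ = c * (s * (c⁻¹ * a)) := by rw [hcomm]
          _ = c * s * c⁻¹ * a := by group
      rw [mul_assoc h a s, this]
      group
    rw [e]
    exact H.mul_mem (H.mul_mem hh (H.mul_mem (H.mul_mem hc hsw.1) (H.inv_mem hc))) (H.inv_mem hh)
  let N : Subgroup (TreeAut d) := Subgroup.closure {x | ∃ g ∈ G, g * s * g⁻¹ = x}
  have hNH : N ≤ H := by
    rw [Subgroup.closure_le]
    rintro _ ⟨g, hg, rfl⟩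
    exact hconj g hg
  have hsN : s ∈ N := Subgroup.subset_closure ⟨1, G.one_mem, by simp⟩
  have hN : N.relIndex G ≠ 0 := by
    refine hji.relIndex_ne_zero (hNH.trans hHG) ?_ fun h0 => hs1 ?_
    · intro n hn g hg
      have hle : N ≤ N.comap (MulAut.conj g).toMonoidHom := by
        rw [Subgroup.closure_le]
        rintro _ ⟨k, hk, rfl⟩
        refine Subgroup.subset_closure ⟨g * k, G.mul_mem hg hk, ?_⟩
        change g * k * s * (g * k)⁻¹ = g * (k * s * k⁻¹) * g⁻¹
        group
      exact hle hn
    · rw [h0] at hsN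
      exact hsN
  intro g hg
  obtain ⟨h, hh, u, hu, rfl⟩ := hH N hN g hg
  exact H.mul_mem hh (hNH hu)

/-! ### Maximal subgroups -/

section Maximal

variable {Γ : Type*} [Group Γ]

theorem exists_isCoatom_finiteIndex {K : Subgroup Γ} (hK : K.FiniteIndex) (hK1 : K ≠ ⊤) :
    ∃ M, IsCoatom M ∧ M.FiniteIndex ∧ K ≤ M := by
  induction hn : K.index using Nat.strong_induction_on generalizing K with
  | _ n ih =>
    by_cases hc : IsCoatom K
    · exact ⟨K, hc, hK, le_rfl⟩
    · obtain ⟨L, hKL, hL⟩ : ∃ L, K < L ∧ L ≠ ⊤ := by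
        by_contra! h
        exact hc ⟨hK1, h⟩
      have hLf : L.FiniteIndex := Subgroup.finiteIndex_of_le hKL.le
      obtain ⟨M, hM, hMf, hLM⟩ := ih L.index (hn ▸ Subgroup.index_strictAnti hKL) hLf hL rfl
      exact ⟨M, hM, hMf, hKL.le.trans hLM⟩

theorem frattiniFinite_normal : (frattiniFinite Γ).Normal := by
  refine ⟨fun n hn g => ?_⟩
  rw [frattiniFinite, Subgroup.mem_sInf] at hn ⊢
  rintro M ⟨hM, hMf⟩
  have hsurj : Function.Surjective (MulAut.conj g).toMonoidHom := (MulAut.conj g).surjective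
  refine hn (M.comap (MulAut.conj g).toMonoidHom)
    ⟨Subgroup.isCoatom_comap_of_surjective hsurj hM, ⟨?_⟩⟩
  rw [Subgroup.index_comap_of_surjective _ hsurj]
  exact hMf.index_ne_zero

/-- Modulo its normal core, M is a maximal subgroup of a finite p-group, and nilpotency provides the
normalizer condition. -/
theorem normal_of_isCoatom_of_isPGroup {p : ℕ} [Fact p.Prime] (hp : IsPGroup p Γ)
    {M : Subgroup Γ} (hM : IsCoatom M) [M.FiniteIndex] : M.Normal := by
  let q := QuotientGroup.mk' M.normalCore
  have hq : Function.Surjective q := QuotientGroup.mk'_surjective _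
  have hker : q.ker ≤ M := by
    rw [QuotientGroup.ker_mk']
    exact M.normalCore_le
  have hcm : (M.map q).comap q = M := Subgroup.comap_map_eq_self hker
  have hMq : IsCoatom (M.map q) := by
    refine ⟨fun h => hM.1 ?_, fun K hK => ?_⟩
    · rw [← hcm, h, Subgroup.comap_top]
    · have h1 : M < K.comap q := by
        refine lt_of_le_of_ne (Subgroup.map_le_iff_le_comap.1 hK.le) fun h => hK.ne ?_
        exact (congrArg (Subgroup.map q) h).trans (Subgroup.map_comap_eq_self_of_surjective hq K)
      rw [← Subgroup.map_comap_eq_self_of_surjective hq K, hM.2 _ h1,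
        Subgroup.map_top_of_surjective _ hq]
  have : Finite (Γ ⧸ M.normalCore) := inferInstance
  have : Group.IsNilpotent (Γ ⧸ M.normalCore) := (hp.to_quotient M.normalCore).isNilpotent
  have hn : (M.map q).Normal :=
    Subgroup.NormalizerCondition.normal_of_coatom _ Group.normalizerCondition_of_isNilpotent hMq
  rw [← hcm]
  infer_instance

/-- By maximality, M and any x outside it generate Γ, so the quotient by M is cyclic. -/
theorem commutator_le_of_isCoatom {M : Subgroup Γ} (hM : IsCoatom M) [M.Normal] :
    commutator Γ ≤ M := by
  rw [← Subgroup.Normal.quotient_commutative_iff_commutator_le]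
  obtain ⟨x, hx⟩ : ∃ x, x ∉ M := by
    by_contra! h
    exact hM.1 (eq_top_iff.2 fun x _ => h x)
  have htop : Subgroup.zpowers x ⊔ M = ⊤ := by
    refine hM.2 _ (lt_of_le_of_ne le_sup_right fun h => hx ?_)
    rw [h]
    exact le_sup_left (a := Subgroup.zpowers x) (Subgroup.mem_zpowers x)
  have hgen : ∀ y : Γ ⧸ M, ∃ i : ℤ, (x : Γ ⧸ M) ^ i = y := by
    intro y
    obtain ⟨y, rfl⟩ := QuotientGroup.mk_surjective y
    have hy : y ∈ ((Subgroup.zpowers x ⊔ M : Subgroup Γ) : Set Γ) := by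
      rw [htop]
      trivial
    rw [Subgroup.mul_normal] at hy
    obtain ⟨_, ⟨i, rfl⟩, m, hm, rfl⟩ := hy
    refine ⟨i, ?_⟩
    have hm1 : (m : Γ ⧸ M) = 1 := (QuotientGroup.eq_one_iff m).2 hm
    simp [hm1]
  refine ⟨⟨fun a b => ?_⟩⟩
  obtain ⟨i, rfl⟩ := hgen a
  obtain ⟨j, rfl⟩ := hgen b
  exact zpow_mul_comm _ _ _

theorem commutator_le_frattiniFinite {p : ℕ} (hp : p.Prime) (hΓ : IsPGroup p Γ) :
    commutator Γ ≤ frattiniFinite Γ := by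
  have : Fact p.Prime := ⟨hp⟩
  refine le_sInf ?_
  rintro M ⟨hM, hMf⟩
  have := normal_of_isCoatom_of_isPGroup hΓ hM
  exact commutator_le_of_isCoatom hM

/-- A subgroup generating `Γ` together with `Φ_F(Γ)` maps onto all finite quotients. -/
theorem sup_eq_top_of_sup_frattiniFinite {H U : Subgroup Γ} (hH : H ⊔ frattiniFinite Γ = ⊤)
    (hU : U.FiniteIndex) : H ⊔ U = ⊤ := by
  by_contra h
  obtain ⟨M, hM, hMf, hle⟩ := exists_isCoatom_finiteIndex
    (Subgroup.finiteIndex_of_le (le_sup_right : U ≤ H ⊔ U)) h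
  refine hM.1 (eq_top_iff.2 (hH ▸ sup_le (le_sup_left.trans hle) (sInf_le ⟨hM, hMf⟩)))

/-- One representative in M for each of the finitely many cosets of N suffices. -/
theorem exists_fg_sup_eq_top {M N : Subgroup Γ} [N.Normal] [Finite (Γ ⧸ N)] (h : M ⊔ N = ⊤) :
    ∃ H ≤ M, H.FG ∧ H ⊔ N = ⊤ := by
  have key : ∀ y : Γ ⧸ N, ∃ m ∈ M, (m : Γ ⧸ N) = y := by
    intro y
    obtain ⟨y, rfl⟩ := QuotientGroup.mk_surjective y
    have hy : y ∈ ((M ⊔ N : Subgroup Γ) : Set Γ) := by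
      rw [h]
      trivial
    rw [Subgroup.mul_normal] at hy
    obtain ⟨m, hm, n, hn, rfl⟩ := hy
    exact ⟨m, hm, by simp [(QuotientGroup.eq_one_iff n).2 hn]⟩
  choose f hf hfq using key
  refine ⟨Subgroup.closure (Set.range f), ?_, ?_, ?_⟩
  · rw [Subgroup.closure_le]
    rintro _ ⟨y, rfl⟩
    exact hf y
  · rw [Subgroup.fg_iff]
    exact ⟨_, rfl, Set.finite_range f⟩
  · rw [eq_top_iff]
    intro x _
    have hx : (f x)⁻¹ * x ∈ N := QuotientGroup.eq.1 (hfq x)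
    rw [← mul_inv_cancel_left (f x) x]
    exact mul_mem (le_sup_left (b := N) (Subgroup.subset_closure ⟨_, rfl⟩))
      (le_sup_right (a := Subgroup.closure (Set.range f)) hx)

end Maximal

theorem IsWeaklyBranch.maximalSubgroupsFiniteIndex [NeZero d] {G : Subgroup (TreeAut d)}
    (hG : IsWeaklyBranch G) (hji : IsJustInfinite G) (hsi : HasSubgroupInduction G)
    (hΦ : frattiniFinite G ≠ ⊥) : MaximalSubgroupsFiniteIndex G := by
  intro M hM
  have hn : (frattiniFinite G).Normal := frattiniFinite_normal
  have hfin : Finite (G ⧸ frattiniFinite G) := hji.2 _ hn hΦ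
  by_contra hMf
  have hsup : M ⊔ frattiniFinite G = ⊤ := by
    refine hM.2 _ (lt_of_le_of_ne le_sup_left fun h => hMf ?_)
    have : (frattiniFinite G).FiniteIndex := Subgroup.finiteIndex_of_finite_quotient
    exact Subgroup.finiteIndex_of_le (sup_eq_left.1 h.symm)
  obtain ⟨H, hHM, hHfg, hHΦ⟩ := exists_fg_sup_eq_top hsup
  have hprod : IsProdense G (H.map G.subtype) := by
    intro U hU g hg
    have hU' : (U.subgroupOf G).FiniteIndex := ⟨hU⟩
    -- Passing to the normal core makes the join a product set, as prodensity requires.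
    have htop := sup_eq_top_of_sup_frattiniFinite hHΦ
      (inferInstance : (U.subgroupOf G).normalCore.FiniteIndex)
    have hg' : (⟨g, hg⟩ : G) ∈ ((H ⊔ (U.subgroupOf G).normalCore : Subgroup G) : Set G) := by
      rw [htop]
      trivial
    rw [Subgroup.mul_normal] at hg'
    obtain ⟨h, hh, u, hu, hhu⟩ := hg'
    exact ⟨h, ⟨h, hh, rfl⟩, u, (U.subgroupOf G).normalCore_le hu, congrArg Subtype.val hhu⟩
  have hle : H.map G.subtype ≤ G := Subgroup.map_subtype_le H
  have hHfg' : (H.map G.subtype).FG := by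
    rw [Subgroup.fg_iff_submonoid_fg] at hHfg ⊢
    exact hHfg.map G.subtype
  have hG' := hprod.le_of_hasInducingTransversal hG hji hle
    (hasSubgroupInduction_iff.1 hsi _ hle hHfg')
  refine hM.1 (eq_top_iff.2 fun g _ => hHM ?_)
  obtain ⟨h, hh, hhg⟩ := hG' g.2
  obtain rfl : h = g := Subtype.ext hhg
  exact hh

/-- If G were abelian, conjugating a nontrivial element of Rist(v) by one taking v to w would leave
it unchanged, yet put it in Rist(w). -/
theorem IsWeaklyBranch.commutator_ne_bot (hd : 2 ≤ d) {G : Subgroup (TreeAut d)}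
    (hG : IsWeaklyBranch G) : commutator G ≠ ⊥ := by
  intro h
  let v : Vertex d := [⟨0, by omega⟩]
  let w : Vertex d := [⟨1, by omega⟩]
  have hvw : v ≠ w := by simp [v, w]
  have := hG.infinite_rist v
  obtain ⟨⟨a, ha⟩, ha1⟩ := exists_ne (1 : rist G v)
  obtain ⟨g, hg, hgv⟩ := hG.transitive 1 v rfl w rfl
  have h1 : g * a * g⁻¹ * a⁻¹ = 1 := by
    have h2 : ⁅(⟨g, hg⟩ : G), (⟨a, ha.1⟩ : G)⁆ ∈ commutator G :=
      Subgroup.commutator_mem_commutator (Subgroup.mem_top _) (Subgroup.mem_top _)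
    rw [h] at h2
    exact congrArg Subtype.val (Subgroup.mem_bot.1 h2)
  have h2 := conj_mem_rist ha hg
  rw [mul_inv_eq_one.1 h1, hgv] at h2
  exact ha1 (Subtype.ext (eq_one_of_mem_rist_of_mem_rist (v := v) (w := w) rfl hvw ha h2))

end BranchGroups

theorem theoremA (d : ℕ) (hd : 2 ≤ d) (G : Subgroup (BranchGroups.TreeAut d))
    (hfg : Group.FG G) (hwb : BranchGroups.IsWeaklyBranch G)
    (hsi : BranchGroups.HasSubgroupInduction G ∨
      (BranchGroups.IsSelfSimilar G ∧ BranchGroups.HasInductiveSubgroupInduction G)) :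
    IsMulTorsion G ∧
      (BranchGroups.IsBranch G →
        BranchGroups.IsJustInfinite G ∧
        (∀ p : ℕ, p.Prime → IsPGroup p G → BranchGroups.MaximalSubgroupsFiniteIndex G) ∧
        (BranchGroups.frattiniFinite G ≠ ⊥ → BranchGroups.MaximalSubgroupsFiniteIndex G)) := by
  have : NeZero d := ⟨by omega⟩
  have hsi' : BranchGroups.HasSubgroupInduction G :=
    hsi.elim id fun h => h.2.hasSubgroupInduction h.1
  have ht := hwb.isMulTorsion hd hsi'
  refine ⟨ht, fun hb => ?_⟩
  have hji := hb.isJustInfinite hfg ht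
  refine ⟨hji, fun p hp hG => ?_, hwb.maximalSubgroupsFiniteIndex hji hsi'⟩
  refine hwb.maximalSubgroupsFiniteIndex hji hsi' fun h0 => hwb.commutator_ne_bot hd ?_
  exact eq_bot_iff.2 (h0 ▸ BranchGroups.commutator_le_frattiniFinite hp hG)
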